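/- Let $X$ be a compact metric space with Borel $\sigma$-algebra $\mathcal B_X$, let $T$ be an action of $\mathbb Z^2$ on $X$ by homeomorphisms $T^{(m,n)}$, and let $\mu$ be a $T$-invariant Borel probability measure on $X$. Let $\beta\in\mathbb R$ and $\vec v=(1,\beta)$. For $b>0$ and $k\ge 1$ put $$\Lambda^{\vec v}(b)=\{(m,n)\in\mathbb Z^2:\ \beta m-b/2\le n\le \beta m+b/2\},\qquad \Lambda^{\vec v}_k(b)=\Lambda^{\vec v}(b)\cap([0,k-1]\times\mathbb Z).$$ On the complex Hilbert space $L^2(X,\mathcal B_X,\mu)$ with $\langle f,g\rangle=\int f\overline g\,d\mu$, write $T^{(m,n)}f=f\circ T^{(m,n)}$. Fix $b_0>0$, and let $\mathcal K^{\vec v}_\mu$ be the collection of all $B\in\mathcal B_X$ for which the closure of $\{T^{(m,n)}1_B:(m,n)\in\Lambda^{\vec v}(b_0)\}$ in $L^2(X,\mathcal B_X,\mu)$ is compact. The system is called $\vec v$-weak mixing if $\mathcal K^{\vec v}_\mu=\{X,\emptyset\}$ modulo $\mu$-null sets, i.e. every $B\in\mathcal K^{\vec v}_\mu$ has $\mu(B)\in\{0,1\}$.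 Theorem. For every $b_0>0$ (used in the definition of $\mathcal K^{\vec v}_\mu$) and every $b>0$, the following are equivalent: (a) $(X,\mathcal B_X,\mu,T)$ is $\vec v$-weak mixing. (b) For every $f\in L^2(X,\mathcal B_X,\mu)$, $$\lim_{k\to\infty}\frac1{\#\Lambda_k^{\vec v}(b)}\sum_{(m,n)\in\Lambda_k^{\vec v}(b)}\bigl|\langle T^{(m,n)}f,f\rangle-\langle f,1\rangle\langle 1,f\rangle\bigr|=0.$$ (c) For all $f,g\in L^2(X,\mathcal B_X,\mu)$, $$\lim_{k\to\infty}\frac1{\#\Lambda_k^{\vec v}(b)}\sum_{(m,n)\in\Lambda_k^{\vec v}(b)}\bigl|\langle T^{(m,n)}f,g\rangle-\langle f,1\rangle\langle 1,g\rangle\bigr|=0.$$ -/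

import Mathlib

open MeasureTheory Filter Topology
open scoped ENNReal

namespace DirectionalWeakMixing

/-- A `ℤ²`-topological dynamical system on `X`: a homomorphism from the additive group `ℤ²` to the
group of homeomorphisms of `X`. -/
abbrev ZTwoAction (X : Type*) [TopologicalSpace X] : Type _ :=
  Multiplicative (ℤ × ℤ) →* (X ≃ₜ X)

/-- The homeomorphism `T^(m,n)`. -/
def ZTwoAction.at {X : Type*} [TopologicalSpace X] (T : ZTwoAction X) (p : ℤ × ℤ) : X ≃ₜ X :=
  T (Multiplicative.ofAdd p)

/-- `μ` is invariant: `μ (T^(-p) A) = μ A` for all `p ∈ ℤ²` and all measurable `A`, where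
`T^(-p) A` is the preimage of `A` under `T^p`. -/
def IsInvariant {X : Type*} [TopologicalSpace X] [MeasurableSpace X]
    (T : ZTwoAction X) (μ : Measure X) : Prop :=
  ∀ (p : ℤ × ℤ) (A : Set X), MeasurableSet A → μ (T.at p ⁻¹' A) = μ A

theorem IsInvariant.measurePreserving {X : Type*} [TopologicalSpace X] [MeasurableSpace X]
    [BorelSpace X] {T : ZTwoAction X} {μ : Measure X} (h : IsInvariant T μ) (p : ℤ × ℤ) :
    MeasurePreserving (T.at p) μ μ := by
  refine ⟨(T.at p).continuous.measurable, ?_⟩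
  ext A hA
  rw [Measure.map_apply (T.at p).continuous.measurable hA, h p A hA]

section Koopman

variable {X : Type*} [TopologicalSpace X] [MeasurableSpace X] [BorelSpace X]

/-- The Koopman operator `U_T^p f = f ∘ T^p` on the complex Hilbert space `L²(X, μ)`. -/
noncomputable def koopman {T : ZTwoAction X} {μ : Measure X} (h : IsInvariant T μ) (p : ℤ × ℤ) :
    Lp ℂ 2 μ →ₗᵢ[ℂ] Lp ℂ 2 μ :=
  Lp.compMeasurePreservingₗᵢ ℂ (T.at p) (h.measurePreserving p)

end Koopman

/-- The inner product `⟨f, g⟩ = ∫ f * conj g dμ` of `L²(X, μ)`, linear in the first variable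
(Mathlib's `inner` is linear in the second one). -/
noncomputable def pairing {X : Type*} [MeasurableSpace X] {μ : Measure X} (f g : Lp ℂ 2 μ) : ℂ :=
  inner ℂ g f

/-- The strip `Λ(b)` of width `b > 0` in the direction `(1, β)`. -/
def strip (β b : ℝ) : Set (ℤ × ℤ) :=
  {p | β * p.1 - b / 2 ≤ p.2 ∧ (p.2 : ℝ) ≤ β * p.1 + b / 2}

theorem finite_strip_inter (β b : ℝ) (k : ℕ) :
    (strip β b ∩ (Set.Icc (0 : ℤ) ((k : ℤ) - 1) ×ˢ Set.univ)).Finite := by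
  refine ((Set.finite_Icc (0 : ℤ) ((k : ℤ) - 1)).biUnion
    (t := fun m => (fun n : ℤ => (m, n)) '' Set.Icc ⌈β * m - b / 2⌉ ⌊β * m + b / 2⌋)
    (fun m _ => (Set.finite_Icc _ _).image _)).subset ?_
  rintro ⟨m, n⟩ ⟨⟨h₁, h₂⟩, hm, -⟩
  exact Set.mem_biUnion hm ⟨n, ⟨Int.ceil_le.2 h₁, Int.le_floor.2 h₂⟩, rfl⟩

/-- The finite set `Λ_k(b) = Λ(b) ∩ ([0, k-1] × ℤ)`. -/
noncomputable def stripTrunc (β b : ℝ) (k : ℕ) : Finset (ℤ × ℤ) :=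
  (finite_strip_inter β b k).toFinset

/-- The average of `a` over `Λ_k(b)`. -/
noncomputable def stripAverage (β b : ℝ) (a : ℤ × ℤ → ℝ) (k : ℕ) : ℝ :=
  (1 / ((stripTrunc β b k).card : ℝ)) * ∑ p ∈ stripTrunc β b k, a p

section Kronecker

variable {X : Type*} [TopologicalSpace X] [MeasurableSpace X] [BorelSpace X]
  {T : ZTwoAction X} {μ : Measure X} [IsFiniteMeasure μ]

/-- The directional Kronecker algebra in the direction `(1, β)`, computed with the strip of
width `b`: the measurable sets `B` for which the orbit of `1_B` along `Λ(b)` has compact closure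
in `L²(X, μ)`. -/
def kroneckerAlgebra (h : IsInvariant T μ) (β b : ℝ) : Set (Set X) :=
  {B | ∃ hB : MeasurableSet B, IsCompact (closure
    ((fun p => koopman h p (indicatorConstLp 2 hB (measure_ne_top μ B) (1 : ℂ))) '' strip β b))}

/-- Weak mixing in the direction `(1, β)`: the directional Kronecker algebra is `{X, ∅}`, as an
equality of `σ`-algebras modulo `μ`-null sets (the inclusion of `∅` and `X` is automatic). -/
def IsDirWeakMixing (h : IsInvariant T μ) (β b : ℝ) : Prop :=
  ∀ B ∈ kroneckerAlgebra h β b, B =ᵐ[μ] (∅ : Set X) ∨ B =ᵐ[μ] (Set.univ : Set X)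

end Kronecker

end DirectionalWeakMixing

/-! The strip is not a subgroup, so the dichotomy between mixing and almost periodicity is proved
with compact operators that almost commute with the action.

Not mixing gives almost periodicity (`exists_almostPeriodic_of_frequently`). If the correlations of
a centered `f` do not vanish in mean, average the rank one operators of the vectors `U p f` with
tent weights in the distance to the line. The averages are bounded in Hilbert–Schmidt norm, so a
weak limit `A` along an ultrafilter is compact. The tent is Lipschitz, so `A` commutes with `U r` up
to a multiple of `|offset β r|`. Finitely many lattice points approximate every offset in the strip;
hence the orbit of `A f` lies near finitely many compact sets. Finally `⟨A f, f⟩ ≠ 0`, and `A f` is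
orthogonal to constants.

Under weak mixing such a vector is zero: `{Re h > 0}` lies in the Kronecker algebra when `h` is
almost periodic, so `Re h` has constant sign and mean zero; the same holds for `I • h`. This proves
(a) → (b). Polarization gives (b) → (c). For (c) → (a), a centered indicator with totally bounded
orbit and vanishing correlations is zero, because a finite net of its orbit detects its norm. -/

namespace DirectionalWeakMixing

/-! ### Geometry and density of strips -/

section Strip

/-- The signed vertical distance of a lattice point from the line of slope `β`. -/
def offset (β : ℝ) (p : ℤ × ℤ) : ℝ := p.2 - β * p.1

theorem offset_add (β : ℝ) (p q : ℤ × ℤ) : offset β (p + q) = offset β p + offset β q := by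
  simp only [offset, Prod.fst_add, Prod.snd_add, Int.cast_add]; ring

theorem offset_sub (β : ℝ) (p q : ℤ × ℤ) : offset β (p - q) = offset β p - offset β q := by
  simp only [offset, Prod.fst_sub, Prod.snd_sub, Int.cast_sub]; ring

theorem mem_strip_iff {β b : ℝ} {p : ℤ × ℤ} : p ∈ strip β b ↔ |offset β p| ≤ b / 2 := by
  rw [abs_le]
  simp only [strip, offset, Set.mem_ofPred_eq]
  constructor <;> rintro ⟨h₁, h₂⟩ <;> constructor <;> linarith

theorem mem_stripTrunc_iff {β b : ℝ} {k : ℕ} {p : ℤ × ℤ} :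
    p ∈ stripTrunc β b k ↔ |offset β p| ≤ b / 2 ∧ 0 ≤ p.1 ∧ p.1 < k := by
  simp only [stripTrunc, Set.Finite.mem_toFinset, Set.mem_inter_iff, mem_strip_iff, Set.mem_prod,
    Set.mem_Icc, Set.mem_univ, and_true]
  refine and_congr_right fun _ => and_congr_right fun _ => ?_
  omega

/-- The offsets in a strip are totally bounded, so finitely many points of the strip approximate
all of it up to a thin strip. -/
theorem exists_finset_offset_net (β b : ℝ) {η : ℝ} (hη : 0 < η) :
    ∃ F : Finset (ℤ × ℤ), ∀ p ∈ strip β b, ∃ q ∈ F, |offset β (p - q)| ≤ η := by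
  have hS : TotallyBounded (offset β '' strip β b) := by
    refine (totallyBounded_Icc (-(b / 2)) (b / 2)).subset ?_
    rintro _ ⟨p, hp, rfl⟩
    exact abs_le.1 (mem_strip_iff.1 hp)
  obtain ⟨t, ht, htf, htc⟩ := Metric.finite_approx_of_totallyBounded hS η hη
  obtain ⟨F, -, hF⟩ := (Set.exists_subset_image_finite_and
    (p := fun u => offset β '' strip β b ⊆ ⋃ y ∈ u, Metric.ball y η)).1 ⟨t, ht, htf, htc⟩
  refine ⟨hF.1.toFinset, fun p hp => ?_⟩
  obtain ⟨y, ⟨q, hq, rfl⟩, hy⟩ := Set.mem_iUnion₂.1 (hF.2 ⟨p, hp, rfl⟩)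
  refine ⟨q, by simpa using hq, ?_⟩
  rw [offset_sub, ← Real.dist_eq]
  exact (Metric.mem_ball.1 hy).le

/-- Finitely many translates of one strip cover any other, which is why the widths `b₀` and `b` may
be unrelated. -/
theorem exists_finset_cover_strip (β b' : ℝ) {b : ℝ} (hb : 0 < b) :
    ∃ F : Finset (ℤ × ℤ), ∀ p ∈ strip β b', ∃ q ∈ F, p - q ∈ strip β b := by
  obtain ⟨F, hF⟩ := exists_finset_offset_net β b' (half_pos hb)
  exact ⟨F, fun p hp => (hF p hp).imp fun q hq => ⟨hq.1, mem_strip_iff.2 hq.2⟩⟩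

/-- Truncated strips have positive lower density. -/
theorem exists_le_card_stripTrunc (β : ℝ) {b : ℝ} (hb : 0 < b) :
    ∃ δ > 0, ∀ᶠ k : ℕ in atTop, δ * k ≤ ((stripTrunc β b k).card : ℝ) := by
  classical
  obtain ⟨F, hF⟩ := exists_finset_cover_strip β 1 hb
  obtain ⟨M, hM⟩ : ∃ M : ℕ, ∀ q ∈ F, |q.1| ≤ M := by
    refine ⟨F.sup fun q => q.1.natAbs, fun q hq => ?_⟩
    have := Finset.le_sup (f := fun q : ℤ × ℤ => q.1.natAbs) hq
    rw [Int.abs_eq_natAbs]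
    exact_mod_cast this
  -- Width 1 is enough to meet every column.
  have hpt : ∀ m : ℤ, (m, round (β * m)) ∈ strip β 1 := fun m => by
    rw [mem_strip_iff, offset, abs_sub_comm]
    simpa using abs_sub_round (β * m)
  have hFne : 0 < F.card := by
    obtain ⟨q, hq, -⟩ := hF _ (hpt 0)
    exact Finset.card_pos.2 ⟨q, hq⟩
  have hcard : ∀ k : ℕ, (k : ℝ) ≤ F.card * (stripTrunc β b k).card + 2 * M := by
    intro k
    -- Translating by `q ∈ F` moves a column by at most `M`, so only the columns at distance `M`
    -- from the ends are sure to be reached.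
    have hsub : Finset.Ico (M : ℤ) (k - M) ⊆
        (F ×ˢ stripTrunc β b k).image fun x => (x.1 + x.2).1 := by
      intro m hm
      rw [Finset.mem_Ico] at hm
      obtain ⟨q, hq, hpq⟩ := hF _ (hpt m)
      have := abs_le.1 (hM q hq)
      refine Finset.mem_image.2 ⟨(q, (m, round (β * m)) - q), ?_, by simp⟩
      rw [Finset.mem_product, mem_stripTrunc_iff]
      refine ⟨hq, mem_strip_iff.1 hpq, ?_, ?_⟩ <;> simp only [Prod.fst_sub] <;> omega
    have h := (Finset.card_le_card hsub).trans Finset.card_image_le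
    rw [Int.card_Ico, Finset.card_product] at h
    have h' : k ≤ F.card * (stripTrunc β b k).card + 2 * M := by omega
    exact_mod_cast h'
  have hF0 : (0 : ℝ) < F.card := by exact_mod_cast hFne
  refine ⟨1 / (2 * F.card), by positivity, ?_⟩
  filter_upwards [eventually_ge_atTop (4 * M)] with k hk
  have hk' : (4 * M : ℝ) ≤ k := by exact_mod_cast hk
  have := hcard k
  rw [one_div, ← div_eq_inv_mul, div_le_iff₀ (by positivity)]
  linarith

end Strip

/-! ### Tent-weighted sums and their translates -/

section WeightedSums

/-- A shift by one changes only the two end terms; induct on `|j|`. The error is independent of `k`,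
so it disappears after division by `k`. -/
theorem norm_sum_range_add_sub_le {E : Type*} [NormedAddCommGroup E] {G : ℤ → E} {C : ℝ}
    (hG : ∀ m, ‖G m‖ ≤ C) (k : ℕ) (j : ℤ) :
    ‖∑ m ∈ Finset.range k, G (m + j) - ∑ m ∈ Finset.range k, G m‖ ≤ 2 * |(j : ℝ)| * C := by
  have hstep : ∀ j : ℤ, ‖∑ m ∈ Finset.range k, G (m + (j + 1)) -
      ∑ m ∈ Finset.range k, G (m + j)‖ ≤ 2 * C := by
    intro j
    have h := Finset.sum_range_sub (fun m : ℕ => G (m + j)) k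
    rw [Finset.sum_sub_distrib] at h
    have h2 : ∀ m : ℕ, G (m + (j + 1)) = G ((m + 1 : ℕ) + j) := fun m => by
      congr 1; push_cast; ring
    simp only [h2, h]
    refine (norm_sub_le _ _).trans ?_
    linarith [hG ((k : ℤ) + j), hG (((0 : ℕ) : ℤ) + j)]
  induction j using Int.induction_on with
  | zero => simp
  | succ i ih =>
    have := norm_sub_le_norm_sub_add_norm_sub (∑ m ∈ Finset.range k, G (m + ((i : ℤ) + 1)))
      (∑ m ∈ Finset.range k, G (m + (i : ℤ))) (∑ m ∈ Finset.range k, G m)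
    have h1 := hstep i
    have hi : |(((i : ℤ) + 1 : ℤ) : ℝ)| = |((i : ℤ) : ℝ)| + 1 := by
      push_cast; rw [abs_of_nonneg (by positivity), abs_of_nonneg (by positivity)]
    rw [hi]; linarith
  | pred i ih =>
    have := norm_sub_le_norm_sub_add_norm_sub (∑ m ∈ Finset.range k, G (m + (-(i : ℤ) - 1)))
      (∑ m ∈ Finset.range k, G (m + (-(i : ℤ)))) (∑ m ∈ Finset.range k, G m)
    have h1 := hstep (-(i : ℤ) - 1)
    rw [sub_add_cancel, norm_sub_rev] at h1
    have hi : |((-(i : ℤ) - 1 : ℤ) : ℝ)| = |((-(i : ℤ) : ℤ) : ℝ)| + 1 := by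
      push_cast
      rw [abs_of_nonpos (by linarith [(Nat.cast_nonneg i : (0 : ℝ) ≤ i)]), abs_neg,
        abs_of_nonneg (by positivity)]
      ring
    rw [hi]; linarith

variable {E : Type*} [NormedAddCommGroup E] [NormedSpace ℝ E]

theorem card_Icc_ceil_floor_le (x : ℝ) {R : ℝ} (hR : 0 ≤ R) :
    ((Finset.Icc ⌈x - R⌉ ⌊x + R⌋).card : ℝ) ≤ 2 * R + 1 := by
  rw [Int.card_Icc]
  rcases le_total 0 (⌊x + R⌋ + 1 - ⌈x - R⌉) with h | h
  · have h' : (((⌊x + R⌋ + 1 - ⌈x - R⌉).toNat : ℤ) : ℝ) = ((⌊x + R⌋ + 1 - ⌈x - R⌉ : ℤ) : ℝ) := by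
      rw [Int.toNat_of_nonneg h]
    rw [Int.cast_natCast] at h'
    rw [h']
    push_cast
    linarith [Int.floor_le (x + R), Int.le_ceil (x - R)]
  · rw [Int.toNat_of_nonpos h]
    norm_num
    linarith

theorem support_smul_subset_Icc (β : ℝ) {ψ : ℝ → ℝ} {R : ℝ} (hψ : ∀ s, R < |s| → ψ s = 0)
    (a : ℤ × ℤ → E) (m : ℤ) :
    (Function.support fun n : ℤ => ψ (offset β (m, n)) • a (m, n)) ⊆
      (Finset.Icc ⌈β * m - R⌉ ⌊β * m + R⌋ : Set ℤ) := by
  intro n hn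
  have h : |offset β (m, n)| ≤ R := by
    by_contra! h
    exact hn (by simp only [hψ _ h, zero_smul])
  simp only [offset] at h
  rw [abs_le] at h
  simp only [Finset.coe_Icc, Set.mem_Icc]
  exact ⟨Int.ceil_le.2 (by linarith), Int.le_floor.2 (by linarith)⟩

theorem norm_finsum_smul_le (β : ℝ) {ψ : ℝ → ℝ} {R M C : ℝ} (hR : 0 ≤ R)
    (hψ : ∀ s, R < |s| → ψ s = 0) (hM : ∀ s, |ψ s| ≤ M) {a : ℤ × ℤ → E} (ha : ∀ p, ‖a p‖ ≤ C)
    (m : ℤ) : ‖∑ᶠ n : ℤ, ψ (offset β (m, n)) • a (m, n)‖ ≤ (2 * R + 1) * (M * C) := by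
  rw [finsum_eq_sum_of_support_subset _ (support_smul_subset_Icc β hψ a m)]
  have hM0 : 0 ≤ M := (abs_nonneg _).trans (hM 0)
  have hC0 : 0 ≤ C := (norm_nonneg _).trans (ha 0)
  refine (norm_sum_le_of_le _ (f := fun n => ψ (offset β (m, n)) • a (m, n))
    (n := fun _ => M * C) fun n _ => ?_).trans ?_
  · rw [norm_smul, Real.norm_eq_abs]
    exact mul_le_mul (hM _) (ha _) (norm_nonneg _) hM0
  · rw [Finset.sum_const, nsmul_eq_mul]
    exact mul_le_mul_of_nonneg_right (card_Icc_ceil_floor_le _ hR) (by positivity)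

/-- The tent function of height `b` supported in `[-b, b]`. -/
noncomputable def tent (b s : ℝ) : ℝ := max 0 (b - |s|)

theorem tent_nonneg (b s : ℝ) : 0 ≤ tent b s := le_max_left _ _

theorem tent_le {b : ℝ} (hb : 0 ≤ b) (s : ℝ) : tent b s ≤ b :=
  max_le hb (by linarith [abs_nonneg s])

theorem tent_eq_zero {b s : ℝ} (h : b ≤ |s|) : tent b s = 0 := max_eq_left (by linarith)

/-- This is the reason for tent weights: a sharp cutoff would not change by a small amount pointwise
under a small change of offset. -/
theorem abs_tent_sub_tent_le (b s t : ℝ) : |tent b s - tent b t| ≤ |s - t| := by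
  refine (abs_max_sub_max_le_max _ _ _ _).trans ?_
  rw [sub_self, abs_zero, max_eq_right (abs_nonneg _), sub_sub_sub_cancel_left, abs_sub_comm s t]
  exact abs_abs_sub_abs_le t s

/-- The tent vanishes outside the strip of half-width `R / 2 ≥ b`, so each column may be summed over
all of `ℤ`. Vertical translation is then a bijection, and only the horizontal range has a boundary.
-/
theorem sum_stripTrunc_tent (β : ℝ) {b R : ℝ} (hR : 2 * b ≤ R) (a : ℤ × ℤ → E) (k : ℕ) :
    ∑ p ∈ stripTrunc β R k, tent b (offset β p) • a p =
      ∑ m ∈ Finset.range k, ∑ᶠ n : ℤ, tent b (offset β ((m : ℤ), n)) • a ((m : ℤ), n) := by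
  classical
  have hψ : ∀ s, R / 2 < |s| → tent b s = 0 := fun s hs => tent_eq_zero (by linarith)
  have h1 : ∀ m : ℕ, ∑ᶠ n : ℤ, tent b (offset β ((m : ℤ), n)) • a ((m : ℤ), n) =
      ∑ n ∈ Finset.Icc ⌈β * (m : ℤ) - R / 2⌉ ⌊β * (m : ℤ) + R / 2⌋,
        tent b (offset β ((m : ℤ), n)) • a ((m : ℤ), n) := fun m =>
    finsum_eq_sum_of_support_subset _ (support_smul_subset_Icc β hψ a m)
  simp only [h1]
  rw [Finset.sum_sigma']
  refine Finset.sum_bij' (fun p _ => ⟨p.1.toNat, p.2⟩) (fun x _ => ((x.1 : ℤ), x.2)) ?_ ?_ ?_ ?_ ?_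
  · intro p hp
    obtain ⟨h, h0, hk⟩ := mem_stripTrunc_iff.1 hp
    simp only [Finset.mem_sigma, Finset.mem_range, Finset.mem_Icc, Int.toNat_of_nonneg h0]
    rw [offset, abs_le] at h
    exact ⟨by omega, Int.ceil_le.2 (by linarith), Int.le_floor.2 (by linarith)⟩
  · rintro ⟨m, n⟩ hx
    simp only [Finset.mem_sigma, Finset.mem_range, Finset.mem_Icc] at hx
    rw [mem_stripTrunc_iff, offset, abs_le]
    have h1 := Int.ceil_le.1 hx.2.1
    have h2 := Int.le_floor.1 hx.2.2
    exact ⟨⟨by linarith, by linarith⟩, by simp, by simpa using hx.1⟩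
  · intro p hp
    obtain ⟨h, h0, hk⟩ := mem_stripTrunc_iff.1 hp
    simp [Int.toNat_of_nonneg h0]
  · rintro ⟨m, n⟩ hx
    simp
  · intro p hp
    obtain ⟨h, h0, hk⟩ := mem_stripTrunc_iff.1 hp
    simp [Int.toNat_of_nonneg h0]

theorem sum_stripTrunc_tent_le (β : ℝ) {b R : ℝ} (hb : 0 ≤ b) (hR : 2 * b ≤ R) (k : ℕ) :
    ∑ p ∈ stripTrunc β R k, tent b (offset β p) ≤ (2 * b + 1) * b * k := by
  have h := sum_stripTrunc_tent β hR (fun _ => (1 : ℝ)) k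
  simp only [smul_eq_mul, mul_one] at h
  rw [h]
  refine (le_abs_self _).trans ?_
  rw [← Real.norm_eq_abs]
  refine (norm_sum_le_of_le _ (n := fun _ => (2 * b + 1) * b) fun m _ => ?_).trans ?_
  · have := norm_finsum_smul_le β (ψ := tent b) (R := b) (M := b) (C := 1) hb
      (fun s hs => tent_eq_zero hs.le)
      (fun s => by rw [abs_of_nonneg (tent_nonneg _ _)]; exact tent_le hb s)
      (a := fun _ => (1 : ℝ)) (by simp) (m : ℤ)
    simpa using this
  · rw [Finset.sum_const, Finset.card_range, nsmul_eq_mul, mul_comm]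

/-- Tent-weighted sums over truncated strips are almost invariant under translations close to the
direction of the strip. -/
theorem norm_sum_stripTrunc_tent_translate_le (β : ℝ) {b R C : ℝ} (hb : 0 ≤ b) (hR : 2 * b ≤ R)
    {a : ℤ × ℤ → E} (ha : ∀ p, ‖a p‖ ≤ C) {r : ℤ × ℤ} (hr : |offset β r| ≤ b) (k : ℕ) :
    ‖∑ p ∈ stripTrunc β R k, tent b (offset β p) • a (p + r) -
      ∑ p ∈ stripTrunc β R k, tent b (offset β p) • a p‖ ≤
      (2 * (2 * b) + 1) * (|offset β r| * C) * k +
        2 * |(r.1 : ℝ)| * ((2 * (2 * b) + 1) * (b * C)) := by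
  rw [sum_stripTrunc_tent β hR a, sum_stripTrunc_tent β hR fun p => a (p + r)]
  -- Reindexing moves the translation from `a` to the weight and the column index. As `|offset β r|
  -- ≤ b`, the shifted tent is supported in `[-2b, 2b]`, whence the factor `2 * (2 * b) + 1`.
  set G : ℤ → E := fun m => ∑ᶠ n : ℤ, tent b (offset β (m, n) - offset β r) • a (m, n) with hG
  have habs : ∀ s, 2 * b < |s| → b ≤ |s - offset β r| := fun s hs => by
    linarith [abs_sub_abs_le_abs_sub s (offset β r)]
  have h1 : ∀ m : ℤ, ∑ᶠ n : ℤ, tent b (offset β (m, n)) • a ((m, n) + r) = G (m + r.1) := by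
    intro m
    rw [hG]
    refine (finsum_comp_equiv (Equiv.addRight r.2) ).symm.trans ?_ |>.symm
    refine finsum_congr fun n => ?_
    have : (m + r.1, Equiv.addRight r.2 n) = (m, n) + r := rfl
    rw [this, offset_add, add_sub_cancel_right]
  have hGb : ∀ m, ‖G m‖ ≤ (2 * (2 * b) + 1) * (b * C) := fun m =>
    norm_finsum_smul_le β (ψ := fun s => tent b (s - offset β r)) (by linarith)
      (fun s hs => tent_eq_zero (habs s hs))
      (fun s => by rw [abs_of_nonneg (tent_nonneg _ _)]; exact tent_le hb _) ha m
  have hsub : ∀ m, ‖G m - ∑ᶠ n : ℤ, tent b (offset β (m, n)) • a (m, n)‖ ≤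
      (2 * (2 * b) + 1) * (|offset β r| * C) := by
    intro m
    have hz1 : ∀ s, 2 * b < |s| → tent b (s - offset β r) = 0 := fun s hs =>
      tent_eq_zero (habs s hs)
    have hz2 : ∀ s, 2 * b < |s| → tent b s = 0 := fun s hs => tent_eq_zero (by linarith)
    have hf1 := (Finset.finite_toSet _).subset (support_smul_subset_Icc β hz1 a m)
    have hf2 := (Finset.finite_toSet _).subset (support_smul_subset_Icc β hz2 a m)
    rw [hG, ← finsum_sub_distrib hf1 hf2]
    simp only [← sub_smul]
    refine norm_finsum_smul_le β (ψ := fun s => tent b (s - offset β r) - tent b s) (by linarith)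
      (fun s hs => by rw [hz1 s hs, hz2 s hs, sub_zero]) (fun s => ?_) ha m
    refine (abs_tent_sub_tent_le _ _ _).trans ?_
    rw [sub_sub_cancel_left, abs_neg]
  simp only [h1]
  refine (norm_sub_le_norm_sub_add_norm_sub _ (∑ m ∈ Finset.range k, G m) _).trans ?_
  rw [add_comm]
  refine add_le_add ?_ (norm_sum_range_add_sub_le hGb k r.1)
  rw [← Finset.sum_sub_distrib]
  refine (norm_sum_le_of_le _ fun (m : ℕ) _ => hsub m).trans ?_
  rw [Finset.sum_const, Finset.card_range, nsmul_eq_mul, mul_comm]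

end WeightedSums

/-! ### Compactness and weak limits in Hilbert space -/

section Hilbert

theorem totallyBounded_of_forall_approx {E : Type*} [PseudoMetricSpace E] {s : Set E}
    (h : ∀ ε > 0, ∃ t : Set E, TotallyBounded t ∧ ∀ x ∈ s, ∃ y ∈ t, dist x y < ε) :
    TotallyBounded s := by
  refine Metric.totallyBounded_iff.2 fun ε hε => ?_
  obtain ⟨t, ht, hst⟩ := h (ε / 2) (half_pos hε)
  obtain ⟨F, hF, hcov⟩ := Metric.totallyBounded_iff.1 ht (ε / 2) (half_pos hε)
  refine ⟨F, hF, fun x hx => ?_⟩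
  obtain ⟨y, hy, hxy⟩ := hst x hx
  obtain ⟨z, hz, hyz⟩ := Set.mem_iUnion₂.1 (hcov hy)
  refine Set.mem_iUnion₂.2 ⟨z, hz, ?_⟩
  rw [Metric.mem_ball] at hyz ⊢
  linarith [dist_triangle x y z]

theorem totallyBounded_biUnion {ι E : Type*} [UniformSpace E] {F : Set ι} (hF : F.Finite)
    {t : ι → Set E} (h : ∀ i ∈ F, TotallyBounded (t i)) : TotallyBounded (⋃ i ∈ F, t i) := by
  induction F, hF using Set.Finite.induction_on with
  | empty => simp
  | insert _ _ ih =>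
    rw [Set.biUnion_insert]
    exact (h _ (Set.mem_insert _ _)).union (ih fun i hi => h i (Set.mem_insert_of_mem _ hi))

variable {H : Type*} [NormedAddCommGroup H] [InnerProductSpace ℂ H]

/-- A Hilbert–Schmidt operator maps bounded sets to totally bounded sets. -/
theorem totallyBounded_image_closedBall_of_sum_sq_le (A : H →L[ℂ] H) {C : ℝ}
    (hA : ∀ s : Finset H, Orthonormal ℂ ((↑) : s → H) → ∑ e ∈ s, ‖A e‖ ^ 2 ≤ C) (R : ℝ) :
    TotallyBounded (A '' Metric.closedBall 0 R) := by
  classical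
  rcases lt_or_ge R 0 with hR | hR
  · simp [Metric.closedBall_eq_empty.2 hR]
  set S : Set ℝ := {c | ∃ s : Finset H, Orthonormal ℂ ((↑) : s → H) ∧ ∑ e ∈ s, ‖A e‖ ^ 2 = c}
  have hSb : BddAbove S := ⟨C, by rintro _ ⟨s, hs, rfl⟩; exact hA s hs⟩
  have hSn : S.Nonempty := ⟨0, ∅, by simp [Orthonormal], by simp⟩
  refine totallyBounded_of_forall_approx fun ε hε => ?_
  set η : ℝ := ε / (R + 1) with hη
  have hη0 : 0 < η := by positivity
  -- Take a finite orthonormal set that nearly attains the supremum. A unit vector `g` orthogonal to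
  -- it can be adjoined, which forces `‖A g‖ ≤ η`; so `A` is within `η` of a finite rank operator.
  obtain ⟨_, ⟨s, hs, rfl⟩, hlt⟩ := exists_lt_of_lt_csSup hSn
    (show sSup S - η ^ 2 < sSup S by linarith [pow_pos hη0 2])
  set V : Submodule ℂ H := Submodule.span ℂ (s : Set H)
  have hunit : ∀ g ∈ Vᗮ, ‖g‖ = 1 → ‖A g‖ ≤ η := by
    intro g hg hg1
    have hgs : ∀ e ∈ s, inner ℂ e g = 0 := fun e he =>
      (Submodule.mem_orthogonal V g).1 hg e (Submodule.subset_span he)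
    have hgn : g ∉ s := fun h => by
      have := hgs g h
      rw [inner_self_eq_zero] at this
      simp [this] at hg1
    have hins : Orthonormal ℂ (fun x : (insert g s : Finset H) => (x : H)) := by
      refine ⟨?_, ?_⟩
      · rintro ⟨x, hx⟩
        rcases Finset.mem_insert.1 hx with rfl | hx
        · exact hg1
        · exact hs.1 ⟨x, hx⟩
      · rintro ⟨x, hx⟩ ⟨y, hy⟩ hxy
        rw [Ne, Subtype.mk.injEq] at hxy
        change inner ℂ x y = 0
        rcases Finset.mem_insert.1 hx with hx | hx <;> rcases Finset.mem_insert.1 hy with hy | hy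
        · exact absurd (hx.trans hy.symm) hxy
        · rw [hx]; exact inner_eq_zero_symm.1 (hgs y hy)
        · rw [hy]; exact hgs x hx
        · exact hs.2 (i := ⟨x, hx⟩) (j := ⟨y, hy⟩) (by simpa using hxy)
    have h1 := le_csSup hSb ⟨_, hins, rfl⟩
    rw [Finset.sum_insert hgn] at h1
    exact le_of_sq_le_sq (by linarith) hη0.le
  have hperp : ∀ g ∈ Vᗮ, ‖A g‖ ≤ η * ‖g‖ := by
    intro g hg
    rcases eq_or_ne g 0 with rfl | hg0
    · simp
    have hn : ‖g‖ ≠ 0 := norm_ne_zero_iff.2 hg0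
    have := hunit (((‖g‖⁻¹ : ℝ) : ℂ) • g) (Vᗮ.smul_mem _ hg) (by
      rw [norm_smul]; simp [hn])
    rw [map_smul, norm_smul, Complex.norm_real, norm_inv, norm_norm, inv_mul_le_iff₀
      (norm_pos_iff.2 hg0)] at this
    linarith
  have : FiniteDimensional ℂ V := FiniteDimensional.span_finset ℂ s
  have : ProperSpace V := FiniteDimensional.proper ℂ V
  refine ⟨A '' (V.subtypeL '' Metric.closedBall 0 R),
    (((isCompact_closedBall _ _).image V.subtypeL.continuous).image A.continuous).totallyBounded,
    ?_⟩
  rintro _ ⟨x, hx, rfl⟩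
  rw [mem_closedBall_zero_iff] at hx
  refine ⟨A (V.starProjection x), ⟨_, ⟨V.orthogonalProjectionOnto x, ?_, rfl⟩, rfl⟩, ?_⟩
  · rw [mem_closedBall_zero_iff]
    exact (V.norm_orthogonalProjectionOnto_apply_le x).trans hx
  · rw [dist_eq_norm, ← map_sub]
    have hmem : x - V.starProjection x ∈ Vᗮ := V.sub_starProjection_mem_orthogonal x
    have hle : ‖x - V.starProjection x‖ ≤ ‖x‖ := by
      rw [← Submodule.starProjection_orthogonal_val]
      exact Vᗮ.norm_starProjection_apply_le x
    calc ‖A (x - V.starProjection x)‖ ≤ η * ‖x - V.starProjection x‖ := hperp _ hmem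
      _ ≤ η * R := by gcongr; exact hle.trans hx
      _ < η * (R + 1) := by gcongr; linarith
      _ = ε := by rw [hη]; field_simp

/-- Bounded sequences of operators on a Hilbert space converge in the weak operator topology along
ultrafilters. -/
theorem exists_weak_limit [CompleteSpace H] {ι : Type*} (𝒰 : Ultrafilter ι) (A : ι → H →L[ℂ] H)
    {C : ℝ} (hA : ∀ k, ‖A k‖ ≤ C) :
    ∃ B : H →L[ℂ] H, ∀ x y, Tendsto (fun k => inner ℂ (A k x) y) 𝒰 (𝓝 (inner ℂ (B x) y)) := by
  have hb : ∀ x y k, ‖inner ℂ (A k x) y‖ ≤ C * ‖x‖ * ‖y‖ := fun x y k =>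
    (norm_inner_le_norm _ _).trans
      (mul_le_mul_of_nonneg_right ((A k).le_of_opNorm_le (hA k) x) (norm_nonneg _))
  have hex : ∀ x y, ∃ c : ℂ, ‖c‖ ≤ C * ‖x‖ * ‖y‖ ∧
      Tendsto (fun k => inner ℂ (A k x) y) 𝒰 (𝓝 c) := by
    intro x y
    obtain ⟨c, hc, hlim⟩ := (isCompact_closedBall (0 : ℂ) (C * ‖x‖ * ‖y‖)).ultrafilter_le_nhds
      (𝒰.map fun k => inner ℂ (A k x) y) (by
        rw [Ultrafilter.coe_map, le_principal_iff, mem_map]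
        exact univ_mem' fun k => by simpa using hb x y k)
    exact ⟨c, by simpa using hc, hlim⟩
  choose L hLb hL using hex
  -- Uniqueness of limits makes the pointwise limits a bounded sesquilinear form, which Riesz
  -- representation turns into an operator.
  let Φ : H →ₗ⋆[ℂ] H →ₗ[ℂ] ℂ := LinearMap.mk₂'ₛₗ (starRingEnd ℂ) (RingHom.id ℂ) L
    (fun x x' y => tendsto_nhds_unique (hL _ _) (by
      simpa only [map_add, inner_add_left] using (hL x y).add (hL x' y)))
    (fun c x y => tendsto_nhds_unique (hL _ _) (by
      simpa only [map_smul, inner_smul_left, smul_eq_mul] using (hL x y).const_mul ((starRingEnd ℂ) c)))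
    (fun x y y' => tendsto_nhds_unique (hL _ _) (by
      simpa only [inner_add_right] using (hL x y).add (hL x y')))
    (fun c x y => tendsto_nhds_unique (hL _ _) (by
      simpa only [inner_smul_right, smul_eq_mul, RingHom.id_apply] using (hL x y).const_mul c))
  refine ⟨InnerProductSpace.continuousLinearMapOfBilin
    (Φ.mkContinuous₂ C fun x y => hLb x y), fun x y => ?_⟩
  rw [InnerProductSpace.continuousLinearMapOfBilin_apply]
  exact hL x y

/-- The norm is lower semicontinuous for weak limits. -/
theorem norm_le_of_weak_limit {ι : Type*} {l : Filter ι} [l.NeBot] {u : ι → H} {x : H} {c : ℝ}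
    {d : ι → ℝ} (hu : ∀ y, Tendsto (fun k => inner ℂ (u k) y) l (𝓝 (inner ℂ x y)))
    (hd : Tendsto d l (𝓝 c)) (hle : ∀ᶠ k in l, ‖u k‖ ≤ d k) : ‖x‖ ≤ c := by
  have h1 : ‖x‖ * ‖x‖ ≤ c * ‖x‖ := by
    have h2 : ‖inner ℂ x x‖ ≤ c * ‖x‖ :=
      le_of_tendsto_of_tendsto (hu x).norm (hd.mul_const ‖x‖) (by
        filter_upwards [hle] with k hk
        exact (norm_inner_le_norm _ _).trans (mul_le_mul_of_nonneg_right hk (norm_nonneg _)))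
    rwa [inner_self_eq_norm_sq_to_K, norm_pow, RCLike.norm_ofReal, abs_norm, sq] at h2
  rcases (norm_nonneg x).eq_or_lt with h0 | h0
  · rw [← h0]
    refine ge_of_tendsto hd ?_
    filter_upwards [hle] with k hk using (norm_nonneg _).trans hk
  · exact le_of_mul_le_mul_right h1 h0

end Hilbert

/-! ### Averaged rank one operators and almost periodic vectors -/

section Averaging

variable {H : Type*} [NormedAddCommGroup H] [InnerProductSpace ℂ H]

/-- `U` is a representation of `ℤ²` by linear isometries. -/
structure IsIsometricRep (U : ℤ × ℤ → H →ₗᵢ[ℂ] H) : Prop where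
  zero : ∀ x, U 0 x = x
  add : ∀ p q x, U (p + q) x = U p (U q x)

/-- The weighted averages of the rank one operators attached to the orbit of `f`. -/
noncomputable def avgOp (U : ℤ × ℤ → H →ₗᵢ[ℂ] H) (f : H) (β b : ℝ) (k : ℕ) : H →L[ℂ] H :=
  (1 / (k : ℝ)) • ∑ p ∈ stripTrunc β (2 * b) k,
    tent b (offset β p) • InnerProductSpace.rankOne ℂ (U p f) (U p f)

variable (U : ℤ × ℤ → H →ₗᵢ[ℂ] H) (f : H) (β : ℝ) {b : ℝ}

theorem avgOp_apply (k : ℕ) (x : H) : avgOp U f β b k x =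
    (1 / (k : ℝ)) • ∑ p ∈ stripTrunc β (2 * b) k,
      tent b (offset β p) • (inner ℂ (U p f) x • U p f) := by
  simp [avgOp]

/-- Each column has bounded total weight, so normalising by `k` instead of the number of points
keeps the mass bounded. -/
theorem one_div_mul_sum_tent_le (hb : 0 ≤ b) (k : ℕ) :
    1 / (k : ℝ) * ∑ p ∈ stripTrunc β (2 * b) k, tent b (offset β p) ≤ (2 * b + 1) * b := by
  rcases Nat.eq_zero_or_pos k with rfl | hk
  · simp; positivity
  · rw [one_div, inv_mul_le_iff₀ (by exact_mod_cast hk), mul_comm (k : ℝ)]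
    exact sum_stripTrunc_tent_le β hb le_rfl k

theorem norm_avgOp_le (hb : 0 ≤ b) (k : ℕ) :
    ‖avgOp U f β b k‖ ≤ (2 * b + 1) * b * ‖f‖ ^ 2 := by
  rw [avgOp, norm_smul, Real.norm_of_nonneg (by positivity)]
  refine (mul_le_mul_of_nonneg_left (norm_sum_le_of_le _
    (n := fun p => tent b (offset β p) * ‖f‖ ^ 2) fun p _ => ?_) (by positivity)).trans ?_
  · rw [norm_smul, Real.norm_of_nonneg (tent_nonneg _ _), InnerProductSpace.norm_rankOne,
      LinearIsometry.norm_map, sq]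
  · rw [← Finset.sum_mul, ← mul_assoc]
    exact mul_le_mul_of_nonneg_right (one_div_mul_sum_tent_le β hb k) (by positivity)

/-- Weighted Cauchy–Schwarz. The squared inner products on the right are in the form that Bessel's
inequality needs. -/
theorem norm_avgOp_apply_sq_le (hb : 0 ≤ b) (k : ℕ) (x : H) :
    ‖avgOp U f β b k x‖ ^ 2 ≤ (2 * b + 1) * b * ‖f‖ ^ 2 *
      (1 / (k : ℝ) * ∑ p ∈ stripTrunc β (2 * b) k,
        tent b (offset β p) * ‖inner ℂ (U p f) x‖ ^ 2) := by
  set w : ℤ × ℤ → ℝ := fun p => tent b (offset β p) with hw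
  have hw0 : ∀ p, 0 ≤ w p := fun p => tent_nonneg _ _
  set T := stripTrunc β (2 * b) k
  have h1 : ‖avgOp U f β b k x‖ ≤
      1 / (k : ℝ) * (∑ p ∈ T, w p * ‖inner ℂ (U p f) x‖) * ‖f‖ := by
    rw [avgOp_apply, norm_smul, Real.norm_of_nonneg (by positivity), mul_assoc, Finset.sum_mul]
    refine mul_le_mul_of_nonneg_left (norm_sum_le_of_le _ fun p _ => le_of_eq ?_) (by positivity)
    rw [norm_smul, norm_smul, Real.norm_of_nonneg (hw0 p), LinearIsometry.norm_map, mul_assoc]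
  have h2 := Finset.sum_sq_le_sum_mul_sum_of_sq_le_mul T
    (r := fun p => w p * ‖inner ℂ (U p f) x‖) (f := w)
    (g := fun p => w p * ‖inner ℂ (U p f) x‖ ^ 2) (fun p _ => hw0 p)
    (fun p _ => mul_nonneg (hw0 p) (sq_nonneg _)) (fun p _ => le_of_eq (by ring))
  have h3 := one_div_mul_sum_tent_le β hb k
  have h4 : 0 ≤ 1 / (k : ℝ) * ∑ p ∈ T, w p * ‖inner ℂ (U p f) x‖ ^ 2 :=
    mul_nonneg (by positivity) (Finset.sum_nonneg fun p _ => mul_nonneg (hw0 p) (sq_nonneg _))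
  calc ‖avgOp U f β b k x‖ ^ 2
      ≤ (1 / (k : ℝ) * (∑ p ∈ T, w p * ‖inner ℂ (U p f) x‖) * ‖f‖) ^ 2 := by gcongr
    _ = (1 / (k : ℝ)) ^ 2 * ‖f‖ ^ 2 * (∑ p ∈ T, w p * ‖inner ℂ (U p f) x‖) ^ 2 := by ring
    _ ≤ (1 / (k : ℝ)) ^ 2 * ‖f‖ ^ 2 *
        ((∑ p ∈ T, w p) * ∑ p ∈ T, w p * ‖inner ℂ (U p f) x‖ ^ 2) := by gcongr
    _ = (1 / (k : ℝ) * ∑ p ∈ T, w p) * (‖f‖ ^ 2 *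
        (1 / (k : ℝ) * ∑ p ∈ T, w p * ‖inner ℂ (U p f) x‖ ^ 2)) := by ring
    _ ≤ (2 * b + 1) * b * (‖f‖ ^ 2 *
        (1 / (k : ℝ) * ∑ p ∈ T, w p * ‖inner ℂ (U p f) x‖ ^ 2)) :=
      mul_le_mul_of_nonneg_right h3 (mul_nonneg (sq_nonneg _) h4)
    _ = _ := by ring

/-- A Hilbert–Schmidt bound uniform in `k`: exchange the sums and apply Bessel to each `U p f`, of
norm `‖f‖`. -/
theorem sum_norm_avgOp_sq_le (hb : 0 ≤ b) (k : ℕ) {s : Finset H}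
    (hs : Orthonormal ℂ ((↑) : s → H)) :
    ∑ e ∈ s, ‖avgOp U f β b k e‖ ^ 2 ≤ ((2 * b + 1) * b * ‖f‖ ^ 2) ^ 2 := by
  have hbessel : ∀ x : H, ∑ e ∈ s, ‖inner ℂ x e‖ ^ 2 ≤ ‖x‖ ^ 2 := fun x => by
    have := hs.sum_inner_products_le x (s := Finset.univ)
    rw [Finset.sum_coe_sort s (fun e => ‖inner ℂ e x‖ ^ 2)] at this
    simpa only [norm_inner_symm x] using this
  set D := (2 * b + 1) * b * ‖f‖ ^ 2 with hD
  have hD0 : 0 ≤ D := by positivity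
  calc ∑ e ∈ s, ‖avgOp U f β b k e‖ ^ 2
      ≤ ∑ e ∈ s, D * (1 / (k : ℝ) * ∑ p ∈ stripTrunc β (2 * b) k,
          tent b (offset β p) * ‖inner ℂ (U p f) e‖ ^ 2) :=
        Finset.sum_le_sum fun e _ => norm_avgOp_apply_sq_le U f β hb k e
    _ = D * (1 / (k : ℝ) * ∑ p ∈ stripTrunc β (2 * b) k,
          tent b (offset β p) * ∑ e ∈ s, ‖inner ℂ (U p f) e‖ ^ 2) := by
        rw [← Finset.mul_sum, ← Finset.mul_sum, Finset.sum_comm]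
        simp only [Finset.mul_sum]
    _ ≤ D * (1 / (k : ℝ) * ∑ p ∈ stripTrunc β (2 * b) k, tent b (offset β p) * ‖f‖ ^ 2) := by
        gcongr with p hp
        · exact tent_nonneg _ _
        · simpa only [LinearIsometry.norm_map] using hbessel (U p f)
    _ ≤ D ^ 2 := by
        rw [← Finset.sum_mul, ← mul_assoc (1 / (k : ℝ)), sq D]
        refine mul_le_mul_of_nonneg_left ?_ hD0
        exact mul_le_mul_of_nonneg_right (one_div_mul_sum_tent_le β hb k) (sq_nonneg _)

variable {U}

/-- Conjugation by `U r` carries the rank one operator of `U p f` to that of `U (p + r) f`, so the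
commutator is the translation error of a tent-weighted sum. Only the term with `|offset β r|`
survives as `k → ∞`. -/
theorem norm_commutator_avgOp_le (hU : IsIsometricRep U) (hb : 0 ≤ b) {r : ℤ × ℤ}
    (hr : |offset β r| ≤ b) {k : ℕ} (hk : 0 < k) (x : H) :
    ‖U r (avgOp U f β b k x) - avgOp U f β b k (U r x)‖ ≤
      ((2 * (2 * b) + 1) * (|offset β r| * ‖f‖ ^ 2) +
        1 / (k : ℝ) * (2 * |(r.1 : ℝ)| * ((2 * (2 * b) + 1) * (b * ‖f‖ ^ 2)))) * ‖x‖ := by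
  set a : ℤ × ℤ → H →L[ℂ] H := fun p => InnerProductSpace.rankOne ℂ (U p f) (U p f) with ha
  have hab : ∀ p, ‖a p‖ ≤ ‖f‖ ^ 2 := fun p => by
    rw [ha, InnerProductSpace.norm_rankOne, LinearIsometry.norm_map, sq]
  have hconj : ∀ p, U r (a p x) = a (p + r) (U r x) := fun p => by
    simp only [ha, InnerProductSpace.rankOne_apply, map_smul, add_comm p r, hU.add,
      LinearIsometry.inner_map_map]
  have h := norm_sum_stripTrunc_tent_translate_le β hb (le_refl (2 * b)) hab hr k
  set S := ∑ p ∈ stripTrunc β (2 * b) k, tent b (offset β p) • a (p + r) -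
      ∑ p ∈ stripTrunc β (2 * b) k, tent b (offset β p) • a p with hS
  have heq : U r (avgOp U f β b k x) - avgOp U f β b k (U r x) = (1 / (k : ℝ)) • S (U r x) := by
    have hreal : ∀ (c : ℝ) (y : H), U r (c • y) = c • U r y := fun c y =>
      map_real_smul (U r).toLinearMap (U r).continuous c y
    rw [avgOp_apply, avgOp_apply, hS, hreal, ← smul_sub, map_sum]
    simp only [hreal, sub_apply, sum_apply, smul_apply, ← hconj]
    rfl
  have hk' : (0 : ℝ) < k := by exact_mod_cast hk
  rw [heq, norm_smul, Real.norm_of_nonneg (by positivity)]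
  calc 1 / (k : ℝ) * ‖S (U r x)‖ ≤ 1 / (k : ℝ) * (‖S‖ * ‖U r x‖) := by
        gcongr; exact S.le_opNorm _
    _ = 1 / (k : ℝ) * ‖S‖ * ‖x‖ := by rw [LinearIsometry.norm_map, mul_assoc]
    _ ≤ _ := by
      gcongr
      refine (mul_le_mul_of_nonneg_left h (by positivity)).trans (le_of_eq ?_)
      field_simp

/-- If the correlations of `f` do not vanish in quadratic mean along the strip, then `f` correlates
with an almost periodic vector in the closed span of its orbit. -/
theorem exists_almostPeriodic_of_frequently [CompleteSpace H] (hU : IsIsometricRep U) (hb : 0 < b)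
    (b' : ℝ) {c : ℝ} (hc : 0 < c) (hf : ∃ᶠ k : ℕ in atTop, c ≤ 1 / (k : ℝ) *
      ∑ p ∈ stripTrunc β (2 * b) k, tent b (offset β p) * ‖inner ℂ (U p f) f‖ ^ 2) :
    ∃ h : H, TotallyBounded ((fun p => U p h) '' strip β b') ∧ inner ℂ h f ≠ 0 ∧
      ∀ z, (∀ p, inner ℂ (U p f) z = 0) → inner ℂ h z = 0 := by
  have hne : (atTop ⊓ 𝓟 {k : ℕ | c ≤ 1 / (k : ℝ) * ∑ p ∈ stripTrunc β (2 * b) k,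
      tent b (offset β p) * ‖inner ℂ (U p f) f‖ ^ 2}).NeBot := frequently_mem_iff_neBot.1 hf
  -- The ultrafilter is concentrated on the times where the average is at least `c`, so this lower
  -- bound passes to the limit.
  obtain ⟨𝒰, h𝒰⟩ := exists_ultrafilter_le (atTop ⊓ 𝓟 {k : ℕ | c ≤ 1 / (k : ℝ) *
    ∑ p ∈ stripTrunc β (2 * b) k, tent b (offset β p) * ‖inner ℂ (U p f) f‖ ^ 2})
  have h𝒰top : (𝒰 : Filter ℕ) ≤ atTop := h𝒰.trans inf_le_left
  have h𝒰c := le_principal_iff.1 (h𝒰.trans inf_le_right)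
  set D := (2 * b + 1) * b * ‖f‖ ^ 2 with hD
  obtain ⟨A, hA⟩ := exists_weak_limit 𝒰 (avgOp U f β b) (norm_avgOp_le U f β hb.le)
  have hA' : ∀ x y, Tendsto (fun k => inner ℂ y (avgOp U f β b k x)) 𝒰 (𝓝 (inner ℂ y (A x))) :=
    fun x y => by
      have := (Complex.continuous_conj.tendsto _).comp (hA x y)
      simpa only [Function.comp_def, inner_conj_symm] using this
  have hHS : ∀ s : Finset H, Orthonormal ℂ ((↑) : s → H) → ∑ e ∈ s, ‖A e‖ ^ 2 ≤ D ^ 2 := by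
    intro s hs
    have hlim : Tendsto (fun k => ∑ e ∈ s, (inner ℂ (A e) (avgOp U f β b k e)).re) 𝒰
        (𝓝 (∑ e ∈ s, (inner ℂ (A e) (A e)).re)) :=
      tendsto_finsetSum _ fun e _ => (Complex.continuous_re.tendsto _).comp (hA' e (A e))
    have hself : ∀ e : H, (inner ℂ (A e) (A e)).re = ‖A e‖ ^ 2 := fun e =>
      inner_self_eq_norm_sq (𝕜 := ℂ) (A e)
    simp only [hself] at hlim
    -- The bound passes to the weak limit by pairing `A e` with the averages at `e` and using `2xy ≤
    -- x² + y²`.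
    have hle : ∑ e ∈ s, ‖A e‖ ^ 2 ≤ (∑ e ∈ s, ‖A e‖ ^ 2 + D ^ 2) / 2 := by
      refine le_of_tendsto hlim (Eventually.of_forall fun k => ?_)
      rw [le_div_iff₀ two_pos]
      refine le_trans ?_ (add_le_add_right (sum_norm_avgOp_sq_le U f β hb.le k hs) _)
      rw [← Finset.sum_add_distrib, Finset.sum_mul]
      refine Finset.sum_le_sum fun e _ => ?_
      have h1 : (inner ℂ (A e) (avgOp U f β b k e)).re ≤ ‖A e‖ * ‖avgOp U f β b k e‖ :=
        (Complex.re_le_norm _).trans (norm_inner_le_norm _ _)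
      nlinarith [sq_nonneg (‖A e‖ - ‖avgOp U f β b k e‖)]
    linarith
  have hcomm : ∀ r, |offset β r| ≤ b → ∀ x,
      ‖U r (A x) - A (U r x)‖ ≤ (2 * (2 * b) + 1) * (|offset β r| * ‖f‖ ^ 2) * ‖x‖ := by
    intro r hr x
    have hinv : ∀ y z, inner ℂ (U r y) z = inner ℂ y (U (-r) z) := fun y z => by
      rw [← LinearIsometry.inner_map_map (U r) y, ← hU.add, add_neg_cancel, hU.zero]
    refine norm_le_of_weak_limit (l := (𝒰 : Filter ℕ))
      (u := fun k => U r (avgOp U f β b k x) - avgOp U f β b k (U r x)) (fun y => ?_) ?_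
      (h𝒰top ((eventually_gt_atTop 0).mono fun k hk =>
        norm_commutator_avgOp_le f β hU hb.le hr hk x))
    · simp only [inner_sub_left, hinv]
      exact (hA _ _).sub (hA _ _)
    · have h0 : Tendsto (fun k : ℕ => 1 / (k : ℝ)) 𝒰 (𝓝 0) :=
        tendsto_one_div_atTop_nhds_zero_nat.mono_left h𝒰top
      simpa using ((h0.mul_const (2 * |(r.1 : ℝ)| * ((2 * (2 * b) + 1) * (b * ‖f‖ ^ 2)))).const_add
        ((2 * (2 * b) + 1) * (|offset β r| * ‖f‖ ^ 2))).mul_const ‖x‖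
  have htb := totallyBounded_image_closedBall_of_sum_sq_le A hHS ‖f‖
  refine ⟨A f, ?_, ?_, ?_⟩
  · refine totallyBounded_of_forall_approx fun ε hε => ?_
    set K := (2 * (2 * b) + 1) * ‖f‖ ^ 2 * ‖f‖ with hK
    have hK0 : 0 ≤ K := by positivity
    set η := min b (ε / (K + 1)) with hη
    have hη0 : 0 < η := lt_min hb (by positivity)
    obtain ⟨F, hF⟩ := exists_finset_offset_net β b' hη0
    refine ⟨⋃ q ∈ (F : Set (ℤ × ℤ)), U q '' (A '' Metric.closedBall 0 ‖f‖),
      totallyBounded_biUnion F.finite_toSet fun q _ =>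
        htb.image (U q).isometry.uniformContinuous, ?_⟩
    rintro _ ⟨p, hp, rfl⟩
    obtain ⟨q, hq, hpq⟩ := hF p hp
    -- Write `U p (A f)` as `U q (U (p - q) (A f))` and commute `A` past `U (p - q)`, whose offset
    -- is at most `η`.
    refine ⟨U q (A (U (p - q) f)), Set.mem_biUnion hq ⟨_, ⟨_, by simp, rfl⟩, rfl⟩, ?_⟩
    have hp' : U p (A f) = U q (U (p - q) (A f)) := by rw [← hU.add, add_sub_cancel]
    simp only [hp']
    rw [(U q).isometry.dist_eq, dist_eq_norm]
    refine (hcomm _ (hpq.trans (min_le_left _ _)) f).trans_lt ?_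
    calc (2 * (2 * b) + 1) * (|offset β (p - q)| * ‖f‖ ^ 2) * ‖f‖
        = |offset β (p - q)| * K := by rw [hK]; ring
      _ ≤ ε / (K + 1) * K := by gcongr; exact hpq.trans (min_le_right _ _)
      _ < ε / (K + 1) * (K + 1) := by gcongr; linarith
      _ = ε := by field_simp
  · intro h0
    -- Before the limit, this real part is exactly the weighted mean of `‖inner ℂ (U p f) f‖ ^ 2`.
    have hle : c ≤ (inner ℂ (A f) f).re := by
      refine ge_of_tendsto ((Complex.continuous_re.tendsto _).comp (hA f f)) ?_
      filter_upwards [h𝒰c] with k hk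
      refine hk.trans (le_of_eq ?_)
      simp only [Function.comp_apply, avgOp_apply]
      rw [← Complex.coe_smul, inner_smul_left, sum_inner, Complex.conj_ofReal, Complex.re_ofReal_mul,
        Complex.re_sum]
      congr 1
      refine Finset.sum_congr rfl fun p _ => ?_
      rw [← Complex.coe_smul, inner_smul_left, inner_smul_left, Complex.conj_ofReal,
        Complex.re_ofReal_mul, mul_comm ((starRingEnd ℂ) _), Complex.mul_conj,
        Complex.normSq_eq_norm_sq, Complex.ofReal_re]
    rw [h0, Complex.zero_re] at hle
    linarith
  · intro z hz
    refine tendsto_nhds_unique (hA f z) ?_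
    have : ∀ k, inner ℂ (avgOp U f β b k f) z = 0 := fun k => by
      rw [avgOp_apply, ← Complex.coe_smul, inner_smul_left, sum_inner, Finset.sum_eq_zero, mul_zero]
      intro p _
      rw [← Complex.coe_smul, inner_smul_left, inner_smul_left, hz, mul_zero, mul_zero]
    simp only [this]
    exact tendsto_const_nhds

end Averaging

/-! ### Averages over truncated strips -/

section StripAverage

variable {β b : ℝ}

theorem stripAverage_nonneg {a : ℤ × ℤ → ℝ} (ha : ∀ p, 0 ≤ a p) (k : ℕ) :
    0 ≤ stripAverage β b a k :=
  mul_nonneg (by positivity) (Finset.sum_nonneg fun p _ => ha p)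

theorem stripAverage_mono {a a' : ℤ × ℤ → ℝ} (h : ∀ p, a p ≤ a' p) (k : ℕ) :
    stripAverage β b a k ≤ stripAverage β b a' k :=
  mul_le_mul_of_nonneg_left (Finset.sum_le_sum fun p _ => h p) (by positivity)

theorem stripAverage_sum {ι : Type*} (s : Finset ι) (a : ι → ℤ × ℤ → ℝ) (k : ℕ) :
    stripAverage β b (fun p => ∑ i ∈ s, a i p) k = ∑ i ∈ s, stripAverage β b (a i) k := by
  simp only [stripAverage]
  rw [Finset.sum_comm, Finset.mul_sum]

theorem card_stripTrunc_pos (hb : 0 ≤ b) {k : ℕ} (hk : 0 < k) : 0 < (stripTrunc β b k).card := by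
  refine Finset.card_pos.2 ⟨0, mem_stripTrunc_iff.2 ⟨?_, le_rfl, ?_⟩⟩
  · simpa [offset] using (by positivity : 0 ≤ b / 2)
  · simpa using hk

/-- If averages of a nonnegative function do not tend to zero, neither do the tent-weighted
averages of its square. -/
theorem exists_frequently_le_of_not_tendsto (hb : 0 < b) {a : ℤ × ℤ → ℝ} (ha : ∀ p, 0 ≤ a p)
    (h : ¬ Tendsto (stripAverage β b a) atTop (𝓝 0)) :
    ∃ c > 0, ∃ᶠ k : ℕ in atTop, c ≤ 1 / (k : ℝ) *
      ∑ p ∈ stripTrunc β (2 * b) k, tent b (offset β p) * a p ^ 2 := by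
  obtain ⟨ε, hε, hfr⟩ : ∃ ε > 0, ∃ᶠ k in atTop, ε ≤ stripAverage β b a k := by
    by_contra! hcon
    refine h (Metric.tendsto_nhds.2 fun ε hε => ?_)
    filter_upwards [hcon ε hε] with k hk
    rw [Real.dist_0_eq_abs, abs_of_nonneg (stripAverage_nonneg ha k)]
    exact hk
  obtain ⟨δ, hδ, hcard⟩ := exists_le_card_stripTrunc β hb
  -- `b / 2` bounds the tent from below on the strip of width `b`, `δ` is the density of the strip,
  -- and `ε ^ 2` comes from Cauchy–Schwarz.
  refine ⟨b / 2 * (δ * ε ^ 2), by positivity, ?_⟩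
  refine (hfr.and_eventually (hcard.and (eventually_gt_atTop 0))).mono ?_
  rintro k ⟨hk, hkN, hk0⟩
  have hk0' : (0 : ℝ) < k := by exact_mod_cast hk0
  set N : ℝ := ((stripTrunc β b k).card : ℝ) with hN
  have hN0 : 0 < N := by rw [hN]; exact_mod_cast card_stripTrunc_pos hb.le hk0
  have hk1 : ε * N ≤ ∑ p ∈ stripTrunc β b k, a p := by
    rwa [stripAverage, one_div, ← div_eq_inv_mul, le_div_iff₀ hN0] at hk
  have hk2 : (ε * N) ^ 2 ≤ N * ∑ p ∈ stripTrunc β b k, a p ^ 2 :=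
    (pow_le_pow_left₀ (by positivity) hk1 2).trans sq_sum_le_card_mul_sum_sq
  have hk3 : ε ^ 2 * N ≤ ∑ p ∈ stripTrunc β b k, a p ^ 2 :=
    le_of_mul_le_mul_left (by linarith [hk2, show (ε * N) ^ 2 = N * (ε ^ 2 * N) by ring]) hN0
  have hsub : stripTrunc β b k ⊆ stripTrunc β (2 * b) k := fun p hp => by
    rw [mem_stripTrunc_iff] at hp ⊢
    exact ⟨hp.1.trans (by linarith), hp.2⟩
  have hk4 : b / 2 * ∑ p ∈ stripTrunc β b k, a p ^ 2 ≤
      ∑ p ∈ stripTrunc β (2 * b) k, tent b (offset β p) * a p ^ 2 := by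
    rw [Finset.mul_sum]
    refine (Finset.sum_le_sum fun p hp => ?_).trans (Finset.sum_le_sum_of_subset_of_nonneg hsub
      fun p _ _ => mul_nonneg (tent_nonneg _ _) (sq_nonneg _))
    refine mul_le_mul_of_nonneg_right (le_max_of_le_right ?_) (sq_nonneg _)
    linarith [(mem_stripTrunc_iff.1 hp).1]
  rw [one_div, ← div_eq_inv_mul, le_div_iff₀ hk0']
  calc b / 2 * (δ * ε ^ 2) * k = b / 2 * (ε ^ 2 * (δ * k)) := by ring
    _ ≤ b / 2 * (ε ^ 2 * N) := by gcongr
    _ ≤ _ := (mul_le_mul_of_nonneg_left hk3 (by positivity)).trans hk4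

end StripAverage

/-! ### Almost periodic vectors along a strip -/

section AlmostPeriodic

variable {H : Type*} [NormedAddCommGroup H] [InnerProductSpace ℂ H] {U : ℤ × ℤ → H →ₗᵢ[ℂ] H}

/-- Almost periodicity along a strip does not depend on its width. -/
theorem totallyBounded_orbit_strip (hU : IsIsometricRep U) {β b : ℝ} (b' : ℝ) (hb : 0 < b) {f : H}
    (hf : TotallyBounded ((fun p => U p f) '' strip β b)) :
    TotallyBounded ((fun p => U p f) '' strip β b') := by
  obtain ⟨F, hF⟩ := exists_finset_cover_strip β b' hb
  refine (totallyBounded_biUnion F.finite_toSet (t := fun q => U q '' ((fun p => U p f) ''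
    strip β b)) fun q _ => hf.image (U q).isometry.uniformContinuous).subset ?_
  rintro _ ⟨p, hp, rfl⟩
  obtain ⟨q, hq, hpq⟩ := hF p hp
  refine Set.mem_biUnion hq ⟨_, ⟨_, hpq, rfl⟩, ?_⟩
  simp only
  rw [← hU.add, add_sub_cancel]

/-- An almost periodic vector with vanishing correlations is zero. -/
theorem eq_zero_of_totallyBounded_of_tendsto {β b : ℝ} (hb : 0 ≤ b) {f : H}
    (hf : TotallyBounded ((fun p => U p f) '' strip β b))
    (h : ∀ g, Tendsto (stripAverage β b fun p => ‖inner ℂ g (U p f)‖) atTop (𝓝 0)) : f = 0 := by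
  by_contra hf0
  have hn : 0 < ‖f‖ := norm_pos_iff.2 hf0
  obtain ⟨t, ht, hcov⟩ := Metric.totallyBounded_iff.1 hf (‖f‖ / 2) (half_pos hn)
  -- Some net point is within `‖f‖ / 2` of `U p f`, so it alone contributes `‖f‖ ^ 2 / 2`. The sum
  -- is finite, so its averages tend to zero, a contradiction.
  have hpt : ∀ p ∈ strip β b, ‖f‖ ^ 2 / 2 ≤ ∑ y ∈ ht.toFinset, ‖inner ℂ y (U p f)‖ := by
    intro p hp
    obtain ⟨y, hy, hyp⟩ := Set.mem_iUnion₂.1 (hcov ⟨p, hp, rfl⟩)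
    rw [Metric.mem_ball, dist_eq_norm] at hyp
    refine le_trans ?_ (Finset.single_le_sum (f := fun y => ‖inner ℂ y (U p f)‖)
      (fun _ _ => norm_nonneg _) (ht.mem_toFinset.2 hy))
    have h1 : ‖inner ℂ (U p f) (U p f)‖ = ‖f‖ ^ 2 := by
      rw [inner_self_eq_norm_sq_to_K, norm_pow, RCLike.norm_ofReal, abs_norm,
        LinearIsometry.norm_map]
    have h2 : ‖inner ℂ (U p f - y) (U p f)‖ ≤ ‖f‖ / 2 * ‖f‖ := by
      refine (norm_inner_le_norm _ _).trans ?_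
      rw [LinearIsometry.norm_map]
      gcongr
    have h3 := norm_sub_norm_le (inner ℂ (U p f) (U p f)) (inner ℂ (U p f - y) (U p f))
    rw [← inner_sub_left, sub_sub_cancel, h1] at h3
    linarith
  have hlim : Tendsto (stripAverage β b fun p => ∑ y ∈ ht.toFinset, ‖inner ℂ y (U p f)‖) atTop
      (𝓝 0) := by
    have := tendsto_finsetSum ht.toFinset fun y _ => h y
    rw [Finset.sum_const_zero] at this
    exact this.congr fun k => (stripAverage_sum _ _ _).symm
  have hge : ‖f‖ ^ 2 / 2 ≤ 0 := by
    refine ge_of_tendsto hlim ((eventually_gt_atTop 0).mono fun k hk => ?_)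
    have hc : (0 : ℝ) < (stripTrunc β b k).card := by exact_mod_cast card_stripTrunc_pos hb hk
    rw [stripAverage, one_div, ← div_eq_inv_mul, le_div_iff₀ hc, mul_comm, ← nsmul_eq_mul]
    exact Finset.card_nsmul_le_sum _ _ _ fun p hp =>
      hpt p (mem_strip_iff.2 (mem_stripTrunc_iff.1 hp).1)
  linarith [pow_pos hn 2]

end AlmostPeriodic

/-! ### The Koopman representation -/

section Koopman

variable {X : Type*} [TopologicalSpace X] [MeasurableSpace X] [BorelSpace X]
  {T : ZTwoAction X} {μ : Measure X} (hμ : IsInvariant T μ)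

theorem coeFn_koopman (p : ℤ × ℤ) (f : Lp ℂ 2 μ) : koopman hμ p f =ᵐ[μ] f ∘ T.at p :=
  Lp.coeFn_compMeasurePreserving f (hμ.measurePreserving p)

theorem isIsometricRep_koopman : IsIsometricRep (koopman hμ) where
  zero f := by
    refine Lp.ext ((coeFn_koopman hμ 0 f).trans ?_)
    have : (T.at 0 : X → X) = id := by
      ext x; simp [ZTwoAction.at]
    rw [this, Function.comp_id]
  add p q f := by
    refine Lp.ext ((coeFn_koopman hμ (p + q) f).trans ?_)
    -- Composition operators reverse the order; commutativity of `ℤ²` restores it.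
    have h : (T.at (p + q) : X → X) = T.at q ∘ T.at p := by
      ext x; rw [add_comm]; simp [ZTwoAction.at, ofAdd_add]
    rw [h, ← Function.comp_assoc]
    refine (((hμ.measurePreserving p).quasiMeasurePreserving.ae_eq_comp
      (coeFn_koopman hμ q f)).symm.trans (coeFn_koopman hμ p (koopman hμ q f)).symm)

theorem koopman_const [IsFiniteMeasure μ] (p : ℤ × ℤ) (c : ℂ) :
    koopman hμ p (Lp.const 2 μ c) = Lp.const 2 μ c := by
  refine Lp.ext ((coeFn_koopman hμ p _).trans ?_)
  exact ((hμ.measurePreserving p).quasiMeasurePreserving.ae_eq_comp (Lp.coeFn_const 2 μ c)).trans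
    (Lp.coeFn_const 2 μ c).symm

theorem koopman_compLp {g : ℂ → ℂ} {K : NNReal} (hg : LipschitzWith K g) (g0 : g 0 = 0)
    (p : ℤ × ℤ) (f : Lp ℂ 2 μ) :
    koopman hμ p (hg.compLp g0 f) = hg.compLp g0 (koopman hμ p f) := by
  refine Lp.ext ((coeFn_koopman hμ p _).trans ?_)
  refine ((hμ.measurePreserving p).quasiMeasurePreserving.ae_eq_comp
    (hg.coeFn_compLp g0 f)).trans ?_
  filter_upwards [hg.coeFn_compLp g0 (koopman hμ p f), coeFn_koopman hμ p f] with x h1 h2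
  rw [h1, Function.comp_apply, Function.comp_apply, Function.comp_apply, h2, Function.comp_apply]

/-- By completeness of `L²`, compact closure is the same as total boundedness. -/
theorem mem_kroneckerAlgebra_iff [IsFiniteMeasure μ] {β b : ℝ} {B : Set X} :
    B ∈ kroneckerAlgebra hμ β b ↔ ∃ hB : MeasurableSet B, TotallyBounded
      ((fun p => koopman hμ p (indicatorConstLp 2 hB (measure_ne_top μ B) (1 : ℂ))) ''
        strip β b) := by
  refine exists_congr fun hB => ⟨fun h => h.totallyBounded.subset subset_closure,
    fun h => h.closure.isCompact_of_isClosed isClosed_closure⟩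

end Koopman

/-! ### From almost periodic functions to almost periodic sets -/

section Truncation

/-- Lipschitz approximations of the indicator function of the right half plane. -/
noncomputable def ramp (n : ℕ) (z : ℂ) : ℂ := (min 1 (n * max z.re 0) : ℝ)

theorem ramp_zero (n : ℕ) : ramp n 0 = 0 := by simp [ramp]

theorem lipschitzWith_ramp (n : ℕ) : LipschitzWith n (ramp n) := by
  refine LipschitzWith.of_dist_le_mul fun z w => ?_
  rw [ramp, ramp, Complex.dist_eq, ← Complex.ofReal_sub, Complex.norm_real, Real.norm_eq_abs]
  refine (abs_min_sub_min_le_max _ _ _ _).trans ?_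
  rw [sub_self, abs_zero, max_eq_right (abs_nonneg _), ← mul_sub, abs_mul, Nat.abs_cast]
  refine mul_le_mul_of_nonneg_left ((abs_max_sub_max_le_max _ _ _ _).trans ?_) (by positivity)
  rw [sub_self, abs_zero, max_eq_left (abs_nonneg _), Complex.dist_eq, ← Complex.sub_re]
  exact Complex.abs_re_le_norm _

theorem norm_ramp_sub_indicator_le (n : ℕ) (z : ℂ) :
    ‖ramp n z - {z : ℂ | 0 < z.re}.indicator (fun _ => (1 : ℂ)) z‖ ≤ 1 := by
  by_cases hz : 0 < z.re
  · rw [Set.indicator_of_mem (by exact hz), ramp, ← Complex.ofReal_one, ← Complex.ofReal_sub,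
      Complex.norm_real, Real.norm_eq_abs, abs_le]
    have h1 := min_le_left (1 : ℝ) (n * max z.re 0)
    have h2 : 0 ≤ min (1 : ℝ) (n * max z.re 0) := le_min zero_le_one (by positivity)
    constructor <;> linarith
  · rw [Set.indicator_of_notMem (by exact hz), ramp, max_eq_right (not_lt.1 hz)]
    simp

theorem tendsto_ramp (z : ℂ) : Tendsto (fun n => ramp n z) atTop
    (𝓝 ({z : ℂ | 0 < z.re}.indicator (fun _ => (1 : ℂ)) z)) := by
  by_cases hz : 0 < z.re
  · rw [Set.indicator_of_mem (by exact hz)]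
    refine tendsto_const_nhds.congr' ?_
    obtain ⟨N, hN⟩ := exists_nat_ge (1 / z.re)
    filter_upwards [eventually_ge_atTop N] with n hn
    have : (1 : ℝ) ≤ n * z.re := by
      rw [← div_le_iff₀ hz]; exact hN.trans (by exact_mod_cast hn)
    rw [ramp, max_eq_left hz.le, min_eq_left this, Complex.ofReal_one]
  · rw [Set.indicator_of_notMem (by exact hz)]
    refine tendsto_const_nhds.congr fun n => ?_
    rw [ramp, max_eq_right (not_lt.1 hz)]
    simp

variable {X : Type*} [MeasurableSpace X] {μ : Measure X}

theorem measurableSet_re_pos (f : Lp ℂ 2 μ) : MeasurableSet {x | 0 < (f x).re} :=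
  measurableSet_lt measurable_const
    (Complex.measurable_re.comp (Lp.stronglyMeasurable f).measurable)

variable [IsProbabilityMeasure μ]

theorem tendsto_ramp_compLp (f : Lp ℂ 2 μ) :
    Tendsto (fun n => (lipschitzWith_ramp n).compLp (ramp_zero n) f) atTop
      (𝓝 (indicatorConstLp 2 (measurableSet_re_pos f) (measure_ne_top μ _) (1 : ℂ))) := by
  set e := indicatorConstLp 2 (measurableSet_re_pos f) (measure_ne_top μ _) (1 : ℂ)
  rw [tendsto_iff_norm_sub_tendsto_zero]
  set u : ℕ → Lp ℂ 2 μ := fun n => (lipschitzWith_ramp n).compLp (ramp_zero n) f - e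
  set v : ℕ → X → ℂ := fun n x =>
    ramp n (f x) - {z : ℂ | 0 < z.re}.indicator (fun _ => (1 : ℂ)) (f x)
  have huv : ∀ n, u n =ᵐ[μ] v n := by
    intro n
    filter_upwards [Lp.coeFn_sub ((lipschitzWith_ramp n).compLp (ramp_zero n) f) e,
      (lipschitzWith_ramp n).coeFn_compLp (ramp_zero n) f,
      indicatorConstLp_coeFn (p := 2) (hs := measurableSet_re_pos f)
        (hμs := measure_ne_top μ _) (c := (1 : ℂ))] with x h1 h2 h3
    rw [h1, Pi.sub_apply, h2, h3]
    rfl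
  -- The error is at most 1 pointwise, and `μ` is finite, so dominated convergence applies.
  have hint : Tendsto (fun n => ∫ x, ‖v n x‖ ^ 2 ∂μ) atTop (𝓝 (∫ _, (0 : ℝ) ∂μ)) := by
    refine tendsto_integral_of_dominated_convergence (fun _ => 1) (fun n => ?_)
      (integrable_const _) (fun n => Eventually.of_forall fun x => ?_)
      (Eventually.of_forall fun x => ?_)
    · exact (((Lp.aestronglyMeasurable (u n)).congr (huv n)).norm.pow 2)
    · rw [norm_pow, norm_norm]
      exact pow_le_one₀ (norm_nonneg _) (norm_ramp_sub_indicator_le n _)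
    · have := ((tendsto_ramp (f x)).sub_const
        ({z : ℂ | 0 < z.re}.indicator (fun _ => (1 : ℂ)) (f x))).norm.pow 2
      simpa using this
  have hsq : ∀ n, ‖u n‖ ^ 2 = ∫ x, ‖v n x‖ ^ 2 ∂μ := by
    intro n
    have h1 : inner ℂ (u n) (u n) = ((∫ x, ‖v n x‖ ^ 2 ∂μ : ℝ) : ℂ) := by
      rw [L2.inner_def, ← integral_complex_ofReal]
      refine integral_congr_ae ?_
      filter_upwards [huv n] with x hx
      rw [hx, inner_self_eq_norm_sq_to_K]
      norm_cast
    rw [← Complex.ofReal_re (∫ x, ‖v n x‖ ^ 2 ∂μ), ← h1]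
    exact (inner_self_eq_norm_sq (𝕜 := ℂ) (u n)).symm
  rw [integral_zero] at hint
  have hlim : Tendsto (fun n => ‖u n‖ ^ 2) atTop (𝓝 0) := hint.congr fun n => (hsq n).symm
  have := hlim.sqrt
  simpa [Real.sqrt_sq (norm_nonneg _)] using this

theorem inner_one_left (f : Lp ℂ 2 μ) : inner ℂ (Lp.const 2 μ (1 : ℂ)) f = ∫ x, f x ∂μ := by
  rw [L2.inner_def]
  refine integral_congr_ae ?_
  filter_upwards [Lp.coeFn_const 2 μ (1 : ℂ)] with x hx
  rw [hx]
  simp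

/-- Either alternative gives `Re f` a constant sign, and a function of constant sign with integral
zero vanishes almost everywhere. -/
theorem re_ae_eq_zero_of_sign {f : Lp ℂ 2 μ} (hf : inner ℂ (Lp.const 2 μ (1 : ℂ)) f = 0)
    (h : {x | 0 < (f x).re} =ᵐ[μ] (∅ : Set X) ∨ {x | 0 < (f x).re} =ᵐ[μ] (Set.univ : Set X)) :
    ∀ᵐ x ∂μ, (f x).re = 0 := by
  have hint : Integrable f μ := (Lp.memLp f).integrable one_le_two
  have h0 : ∫ x, (f x).re ∂μ = 0 := by
    have := integral_re hint
    rw [← inner_one_left, hf] at this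
    simpa using this
  rcases h with h | h
  · have hle : 0 ≤ᵐ[μ] fun x => -(f x).re := by
      filter_upwards [eventuallyEq_set.1 h] with x hx
      have : ¬ 0 < (f x).re := fun h' => (hx.1 h').elim
      simpa using this
    have := (integral_eq_zero_iff_of_nonneg_ae hle hint.re.neg).1 (by
      rw [integral_neg, h0, neg_zero])
    filter_upwards [this] with x hx
    simpa using hx
  · have hle : 0 ≤ᵐ[μ] fun x => (f x).re := by
      filter_upwards [eventuallyEq_set.1 h] with x hx
      exact (hx.2 trivial).le
    exact (integral_eq_zero_iff_of_nonneg_ae hle hint.re).1 h0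

/-- The component of `f` orthogonal to the constants. -/
noncomputable def centered (f : Lp ℂ 2 μ) : Lp ℂ 2 μ :=
  f - inner ℂ (Lp.const 2 μ (1 : ℂ)) f • Lp.const 2 μ (1 : ℂ)

theorem inner_one_centered (f : Lp ℂ 2 μ) :
    inner ℂ (Lp.const 2 μ (1 : ℂ)) (centered f) = 0 := by
  have h1 : inner ℂ (Lp.const 2 μ (1 : ℂ)) (Lp.const 2 μ (1 : ℂ)) = 1 := by
    rw [inner_one_left, integral_congr_ae (Lp.coeFn_const 2 μ (1 : ℂ))]
    simp
  rw [centered, inner_sub_right, inner_smul_right, h1, mul_one, sub_self]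

end Truncation

/-! ### The three implications -/

section WeakMixing

variable {X : Type*} [TopologicalSpace X] [MeasurableSpace X] [BorelSpace X]
  {T : ZTwoAction X} {μ : Measure X} [IsProbabilityMeasure μ] {hμ : IsInvariant T μ} {β b : ℝ}

/-- Applying a Lipschitz function is uniformly continuous on `L²` and commutes with the action, so
it preserves total boundedness of orbits. The ramps approximate the indicator uniformly along the
orbit because the action is isometric. -/
theorem re_pos_mem_kroneckerAlgebra {f : Lp ℂ 2 μ}
    (hf : TotallyBounded ((fun p => koopman hμ p f) '' strip β b)) :
    {x | 0 < (f x).re} ∈ kroneckerAlgebra hμ β b := by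
  refine (mem_kroneckerAlgebra_iff hμ).2 ⟨measurableSet_re_pos f, ?_⟩
  refine totallyBounded_of_forall_approx fun ε hε => ?_
  obtain ⟨n, hn⟩ := ((Metric.tendsto_nhds.1 (tendsto_ramp_compLp f)) ε hε).exists
  refine ⟨_, hf.image ((lipschitzWith_ramp n).lipschitzWith_compLp
    (ramp_zero n)).uniformContinuous, ?_⟩
  rintro _ ⟨p, hp, rfl⟩
  refine ⟨_, ⟨_, ⟨p, hp, rfl⟩, rfl⟩, ?_⟩
  simp only
  rw [← koopman_compLp, (koopman hμ p).isometry.dist_eq, dist_comm]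
  exact hn

theorem IsDirWeakMixing.eq_zero (h : IsDirWeakMixing hμ β b) {f : Lp ℂ 2 μ}
    (hf : TotallyBounded ((fun p => koopman hμ p f) '' strip β b))
    (hf1 : inner ℂ (Lp.const 2 μ (1 : ℂ)) f = 0) : f = 0 := by
  have hre := re_ae_eq_zero_of_sign hf1 (h _ (re_pos_mem_kroneckerAlgebra hf))
  have hI : TotallyBounded ((fun p => koopman hμ p (Complex.I • f)) '' strip β b) := by
    refine (hf.image (uniformContinuous_const_smul Complex.I)).subset ?_
    rintro _ ⟨p, hp, rfl⟩
    exact ⟨_, ⟨p, hp, rfl⟩, ((koopman hμ p).map_smul _ _).symm⟩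
  have him := re_ae_eq_zero_of_sign (f := Complex.I • f) (by rw [inner_smul_right, hf1, mul_zero])
    (h _ (re_pos_mem_kroneckerAlgebra hI))
  refine (Lp.eq_zero_iff_ae_eq_zero).2 ?_
  filter_upwards [hre, him, Lp.coeFn_smul Complex.I f] with x h1 h2 h3
  rw [h3] at h2
  refine Complex.ext h1 ?_
  simpa using h2

variable (hμ)

theorem pairing_koopman_sub (p : ℤ × ℤ) (f g : Lp ℂ 2 μ) :
    pairing (koopman hμ p f) g - pairing f (Lp.const 2 μ (1 : ℂ)) *
      pairing (Lp.const 2 μ (1 : ℂ)) g = inner ℂ g (koopman hμ p (centered f)) := by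
  rw [centered, map_sub, map_smul, koopman_const, inner_sub_right, inner_smul_right]
  rfl

/-- The action preserves the orthogonal complement of the constants, so correlations of `f` are
autocorrelations of its centered part. -/
theorem inner_koopman_centered (p : ℤ × ℤ) (f : Lp ℂ 2 μ) :
    inner ℂ f (koopman hμ p (centered f)) =
      inner ℂ (centered f) (koopman hμ p (centered f)) := by
  have h : inner ℂ (Lp.const 2 μ (1 : ℂ)) (koopman hμ p (centered f)) = 0 := by
    rw [← koopman_const hμ p, LinearIsometry.inner_map_map, inner_one_centered]
  conv_rhs => rw [centered, inner_sub_left, inner_smul_left]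
  rw [← centered, h, mul_zero, sub_zero]

variable {hμ}

theorem IsDirWeakMixing.tendsto_self {b₀ : ℝ} (h : IsDirWeakMixing hμ β b₀) (hb : 0 < b)
    (f : Lp ℂ 2 μ) : Tendsto (stripAverage β b fun p =>
      ‖inner ℂ f (koopman hμ p (centered f))‖) atTop (𝓝 0) := by
  by_contra hcon
  obtain ⟨c, hc, hfr⟩ := exists_frequently_le_of_not_tendsto hb (fun _ => norm_nonneg _) hcon
  simp only [inner_koopman_centered, norm_inner_symm (centered f)] at hfr
  -- The averages use width `b`, but the almost periodic vector is requested for width `b₀`, the one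
  -- in the hypothesis.
  obtain ⟨g, hg, hne, hperp⟩ := exists_almostPeriodic_of_frequently (centered f) β
    (isIsometricRep_koopman hμ) hb b₀ hc hfr
  have h1 : inner ℂ g (Lp.const 2 μ (1 : ℂ)) = 0 := hperp _ fun p => by
    rw [← koopman_const hμ p, LinearIsometry.inner_map_map, inner_eq_zero_symm,
      inner_one_centered]
  rw [h.eq_zero hg (inner_eq_zero_symm.1 h1), inner_zero_left] at hne
  exact hne rfl

theorem four_mul_inner_map_eq {H : Type*} [NormedAddCommGroup H] [InnerProductSpace ℂ H]
    (A : H →ₗ[ℂ] H) (f g : H) : 4 * inner ℂ g (A f) =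
      inner ℂ (f + g) (A (f + g)) - inner ℂ (f - g) (A (f - g)) +
      Complex.I * (inner ℂ (f + Complex.I • g) (A (f + Complex.I • g)) -
        inner ℂ (f - Complex.I • g) (A (f - Complex.I • g))) := by
  simp only [map_add, map_sub, map_smul, inner_add_left, inner_add_right, inner_sub_left,
    inner_sub_right, inner_smul_left, inner_smul_right, Complex.conj_I]
  linear_combination (2 * inner ℂ g (A f) - 2 * inner ℂ f (A g)) * Complex.I_sq

/-- Polarization of the correlation averages. -/
theorem tendsto_of_forall_tendsto_self
    (h : ∀ f : Lp ℂ 2 μ, Tendsto (stripAverage β b fun p =>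
      ‖inner ℂ f (koopman hμ p (centered f))‖) atTop (𝓝 0)) (f g : Lp ℂ 2 μ) :
    Tendsto (stripAverage β b fun p => ‖inner ℂ g (koopman hμ p (centered f))‖) atTop (𝓝 0) := by
  let P : Lp ℂ 2 μ →ₗ[ℂ] Lp ℂ 2 μ :=
    { toFun := centered
      map_add' := fun x y => by
        simp only [centered, inner_add_right, add_smul]; abel
      map_smul' := fun c x => by
        simp only [centered, inner_smul_right, mul_smul, smul_sub, RingHom.id_apply] }
  let w : Fin 4 → Lp ℂ 2 μ := ![f + g, f - g, f + Complex.I • g, f - Complex.I • g]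
  have hlim : Tendsto (stripAverage β b fun p =>
      ∑ i, ‖inner ℂ (w i) (koopman hμ p (centered (w i)))‖) atTop (𝓝 0) := by
    have := tendsto_finsetSum Finset.univ fun i _ => h (w i)
    rw [Finset.sum_const_zero] at this
    exact this.congr fun k => (stripAverage_sum _ _ _).symm
  refine squeeze_zero (stripAverage_nonneg fun _ => norm_nonneg _) (stripAverage_mono fun p => ?_)
    hlim
  -- Centering is linear, so polarization applies for each `p`, with four vectors independent of
  -- `p`.
  have hpol := four_mul_inner_map_eq ((koopman hμ p).toLinearMap ∘ₗ P) f g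
  have hn := congrArg norm hpol
  rw [norm_mul] at hn
  have h4 : ‖(4 : ℂ)‖ = 4 := by norm_num
  rw [h4] at hn
  have hle : 4 * ‖inner ℂ g (koopman hμ p (centered f))‖ ≤
      ∑ i, ‖inner ℂ (w i) (koopman hμ p (centered (w i)))‖ := by
    refine hn.le.trans ((norm_add_le _ _).trans ?_)
    rw [norm_mul, Complex.norm_I, one_mul, Fin.sum_univ_four]
    refine (add_le_add (norm_sub_le _ _) (norm_sub_le _ _)).trans (le_of_eq ?_)
    rw [← add_assoc]
    rfl
  linarith [norm_nonneg (inner ℂ g (koopman hμ p (centered f)))]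

/-- The centered indicator of `B` is almost periodic with vanishing correlations, hence zero; so the
indicator is almost everywhere constant. -/
theorem isDirWeakMixing_of_tendsto {b₀ : ℝ} (hb₀ : 0 < b₀) (hb : 0 < b)
    (h : ∀ f g : Lp ℂ 2 μ, Tendsto (stripAverage β b fun p =>
      ‖inner ℂ g (koopman hμ p (centered f))‖) atTop (𝓝 0)) : IsDirWeakMixing hμ β b₀ := by
  intro B hBK
  obtain ⟨hB, htb⟩ := (mem_kroneckerAlgebra_iff hμ).1 hBK
  set f := indicatorConstLp 2 hB (measure_ne_top μ B) (1 : ℂ)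
  set c := inner ℂ (Lp.const 2 μ (1 : ℂ)) f
  have htb' : TotallyBounded ((fun p => koopman hμ p (centered f)) '' strip β b) := by
    have h1 := totallyBounded_orbit_strip (isIsometricRep_koopman hμ) b hb₀ htb
    -- Constants are fixed by the action, so centering only translates the orbit by a fixed vector.
    refine (h1.image (uniformContinuous_id.sub (uniformContinuous_const
      (b := c • Lp.const 2 μ (1 : ℂ))))).subset ?_
    rintro _ ⟨p, hp, rfl⟩
    refine ⟨_, ⟨p, hp, rfl⟩, ?_⟩
    simp only [centered, map_sub, map_smul, koopman_const, id]
    rfl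
  have h0 := eq_zero_of_totallyBounded_of_tendsto hb.le htb' (h f)
  rw [centered, sub_eq_zero] at h0
  have hae : ∀ᵐ x ∂μ, B.indicator (fun _ => (1 : ℂ)) x = c := by
    filter_upwards [indicatorConstLp_coeFn (p := 2) (hs := hB) (hμs := measure_ne_top μ B)
      (c := (1 : ℂ)), Lp.coeFn_smul c (Lp.const 2 μ (1 : ℂ)),
      Lp.coeFn_const 2 μ (1 : ℂ)] with x h1 h2 h3
    rw [← h1]
    change f x = c
    rw [h0, h2, Pi.smul_apply, h3]
    simp
  by_cases hc : c = 1
  · right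
    filter_upwards [hae] with x hx
    rw [hc] at hx
    have : x ∈ B := by
      by_contra hxB
      rw [Set.indicator_of_notMem hxB] at hx
      exact zero_ne_one hx
    exact propext ⟨fun _ => trivial, fun _ => this⟩
  · left
    filter_upwards [hae] with x hx
    have : x ∉ B := fun hxB => by
      rw [Set.indicator_of_mem hxB] at hx
      exact hc hx.symm
    exact propext ⟨fun h => this h, fun h => h.elim⟩

end WeakMixing

end DirectionalWeakMixing

theorem mainTheorem10 {X : Type*} [MetricSpace X] [CompactSpace X] [MeasurableSpace X]
    [BorelSpace X] (T : DirectionalWeakMixing.ZTwoAction X) (μ : Measure X)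
    [IsProbabilityMeasure μ] (hμ : DirectionalWeakMixing.IsInvariant T μ)
    (β : ℝ) (b₀ b : ℝ) (hb₀ : 0 < b₀) (hb : 0 < b) :
    List.TFAE [
      DirectionalWeakMixing.IsDirWeakMixing hμ β b₀,
      ∀ f : Lp ℂ 2 μ, Tendsto (DirectionalWeakMixing.stripAverage β b (fun p =>
        ‖DirectionalWeakMixing.pairing (DirectionalWeakMixing.koopman hμ p f) f
          - DirectionalWeakMixing.pairing f (Lp.const 2 μ (1 : ℂ))
            * DirectionalWeakMixing.pairing (Lp.const 2 μ (1 : ℂ)) f‖)) atTop (𝓝 0),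
      ∀ f g : Lp ℂ 2 μ, Tendsto (DirectionalWeakMixing.stripAverage β b (fun p =>
        ‖DirectionalWeakMixing.pairing (DirectionalWeakMixing.koopman hμ p f) g
          - DirectionalWeakMixing.pairing f (Lp.const 2 μ (1 : ℂ))
            * DirectionalWeakMixing.pairing (Lp.const 2 μ (1 : ℂ)) g‖)) atTop (𝓝 0)] := by
  simp only [DirectionalWeakMixing.pairing_koopman_sub]
  tfae_have 1 → 2 := fun h f => h.tendsto_self hb f
  tfae_have 2 → 3 := DirectionalWeakMixing.tendsto_of_forall_tendsto_self
  tfae_have 3 → 1 := DirectionalWeakMixing.isDirWeakMixing_of_tendsto hb₀ hb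
  tfae_finish
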